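/- Let $k$ be an algebraically closed field of characteristic zero and let $\mathcal C$ be a modular tensor category over $k$, in the following (not necessarily semisimple) sense. $\mathcal C$ is a finite $k$-linear category (equivalent, as a $k$-linear category, to the category of finite-dimensional modules over a finite-dimensional $k$-algebra) and a rigid monoidal category with $k$-bilinear tensor product and simple unit $\mathbb 1$; every object $X$ has a dual $X^*$ with $\mathrm{ev}_X\colon X^*\otimes X\to\mathbb 1$ and $\mathrm{coev}_X\colon\mathbb 1\to X\otimes X^*$. It carries a braiding $\beta$ and a twist, i.e. a natural automorphism $\theta$ of the identity functor with $\theta_{X\otimes Y}=\beta_{Y,X}\circ\beta_{X,Y}\circ(\theta_X\otimes\theta_Y)$ and $(\theta_X)^*=\theta_{X^*}$. Finally, the Hopf pairing $\omega\colon L\otimes L\to\mathbb 1$ on the coend $L=\int^{X\in\mathcal C}X^*\otimes X$ (with universal dinatural maps $\iota_X$), determined by $$\omega\circ(\iota_X\otimes\iota_Y)=(\mathrm{ev}_X\otimes\mathrm{ev}_Y)\circ\bigl(\mathrm{id}_{X^*}\otimes(\beta_{Y^*,X}\circ\beta_{X,Y^*})\otimes\mathrm{id}_Y\bigr),$$ is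 non-degenerate, i.e. there is a copairing $\mathbb 1\to L\otimes L$ satisfying both zig-zag identities with $\omega$. Let $\mathcal Z(\mathcal C)$ be the Drinfeld centre, with objects the pairs $(X,\gamma)$ of an object $X$ and a half-braiding $\gamma\colon X\otimes -\Rightarrow -\otimes X$, and let $U\colon\mathcal Z(\mathcal C)\to\mathcal C$, $(X,\gamma)\mapsto X$, be the forgetful functor. Then: 1. $U$ has a two-sided adjoint: there is a $k$-linear functor $F\colon\mathcal C\to\mathcal Z(\mathcal C)$ which is both left adjoint and right adjoint to $U$. 2. For every object $M$ the coend $Z(M)=\int^{X\in\mathcal C}X^*\otimes M\otimes X$ exists, and the monad $U\circ F$ of the adjunction $F\dashv U$ is isomorphic, as a monad on $\mathcal C$ (in particular naturally in $M$), to the central monad $Z$. The unit of $Z$ is the map $M\cong\mathbb 1^*\otimes M\otimes\mathbb 1\to Z(M)$, and its multiplication $Z(Z(M))\to Z(M)$ is induced by the maps $Y^*\otimes(X^*\otimes M\otimes X)\otimes Y\cong(X\otimes Y)^*\otimes M\otimes(X\otimes Y)\to Z(M)$. -/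

import Mathlib

open CategoryTheory MonoidalCategory Limits Opposite

universe w v u

namespace ModularTensor

/-! ### Finite linear categories, ribbon categories -/

/-- A `k`-linear category is finite if it is equivalent, as a `k`-linear category, to the category
of finite dimensional modules over some finite dimensional `k`-algebra. (Over a finite dimensional
algebra, finitely generated modules and finite dimensional modules agree.) -/
def IsFiniteLinear (k : Type w) [Field k] (C : Type u) [Category.{v} C] [Preadditive C]
    [Linear k C] : Prop :=
  ∃ (A : Type w) (_ : Ring A) (_ : Algebra k A) (_ : Module.Finite k A)
    (E : C ≌ FGModuleCat.{w} A), ∃ (_ : E.functor.Additive), E.functor.Linear k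

/-- A ribbon structure (twist) on a rigid braided monoidal category. -/
class RibbonCategory (C : Type u) [Category.{v} C] [MonoidalCategory C] [RigidCategory C]
    [BraidedCategory C] where
  /-- The twist, a natural automorphism of the identity functor. -/
  twist : 𝟭 C ≅ 𝟭 C
  twist_tensor : ∀ X Y : C, twist.hom.app (X ⊗ Y) =
    ((twist.hom.app X : X ⟶ X) ⊗ₘ (twist.hom.app Y : Y ⟶ Y)) ≫ (β_ X Y).hom ≫ (β_ Y X).hom
  twist_dual : ∀ X : C,
    rightAdjointMate (twist.hom.app X : X ⟶ X) = (twist.hom.app Xᘁ : Xᘁ ⟶ Xᘁ)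

section Coends

variable (C : Type u) [Category.{v} C] [MonoidalCategory C] [RigidCategory C]

/-- The functor `(X, Y) ↦ X* ⊗ Y`. The dual `X* = Xᘁ` has
`ev : X* ⊗ X ⟶ 𝟙` and `coev : 𝟙 ⟶ X ⊗ X*`. -/
@[simps]
def innerHom : Cᵒᵖ ⥤ C ⥤ C where
  obj X :=
    { obj := fun Y => X.unopᘁ ⊗ Y
      map := fun f => X.unopᘁ ◁ f }
  map g := { app := fun Y => rightAdjointMate g.unop ▷ Y
             naturality := fun _ _ f => whisker_exchange _ _ }
  map_id X := by ext; simp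
  map_comp f g := by ext; simp [comp_rightAdjointMate]

/-- The functor `(X, Y) ↦ X* ⊗ (M ⊗ Y)`. -/
@[simps]
def centralBifunctorObj (M : C) : Cᵒᵖ ⥤ C ⥤ C where
  obj X :=
    { obj := fun Y => X.unopᘁ ⊗ (M ⊗ Y)
      map := fun f => X.unopᘁ ◁ (M ◁ f) }
  map g :=
    { app := fun Y => rightAdjointMate g.unop ▷ (M ⊗ Y)
      naturality := fun _ _ f => whisker_exchange _ _ }
  map_id X := by
    ext Y
    simp only [unop_id, rightAdjointMate_id, id_whiskerRight, NatTrans.id_app]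
  map_comp f g := by
    ext Y
    simp only [unop_comp, comp_rightAdjointMate, comp_whiskerRight, NatTrans.comp_app]

/-- The functor `M ↦ ((X, Y) ↦ X* ⊗ (M ⊗ Y))`. -/
@[simps]
def centralBifunctor : C ⥤ Cᵒᵖ ⥤ C ⥤ C where
  obj M := centralBifunctorObj C M
  map f :=
    { app := fun X =>
        { app := fun Y => X.unopᘁ ◁ (f ▷ Y)
          naturality := fun Y Y' g => by
            have h := congrArg (fun t => X.unopᘁ ◁ t) (whisker_exchange f g)
            simp only [MonoidalCategory.whiskerLeft_comp] at h
            exact h }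
      naturality := fun X X' g => by
        ext Y
        exact (whisker_exchange _ _).symm }
  map_id M := by
    ext X Y
    simp only [id_whiskerRight, MonoidalCategory.whiskerLeft_id]
    rfl
  map_comp f g := by
    ext X Y
    simp only [comp_whiskerRight, MonoidalCategory.whiskerLeft_comp]
    rfl

end Coends

/-! ### Modularity: the Hopf pairing on the coend `∫^X X* ⊗ X` -/

section Modular

variable {C : Type u} [Category.{v} C] [MonoidalCategory C] [RigidCategory C] [BraidedCategory C]

/-- The morphism `X* ⊗ X ⊗ Y* ⊗ Y ⟶ 𝟙` given by the double braiding of `X` with `Y*` followed by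
`ev_X ⊗ ev_Y`. -/
def hopfPairingComponent (X Y : C) : (Xᘁ ⊗ X) ⊗ (Yᘁ ⊗ Y) ⟶ 𝟙_ C :=
  (α_ Xᘁ X (Yᘁ ⊗ Y)).hom ≫ Xᘁ ◁ (α_ X Yᘁ Y).inv ≫
    Xᘁ ◁ (((β_ X Yᘁ).hom ≫ (β_ Yᘁ X).hom) ▷ Y) ≫
    Xᘁ ◁ (α_ X Yᘁ Y).hom ≫ (α_ Xᘁ X (Yᘁ ⊗ Y)).inv ≫
    (ε_ X Xᘁ ⊗ₘ ε_ Y Yᘁ) ≫ (λ_ (𝟙_ C)).hom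

/-- A pairing `ω : L ⊗ L ⟶ 𝟙` is non-degenerate if there is a copairing `𝟙 ⟶ L ⊗ L` such that
both zig-zag identities hold. -/
def IsNondegeneratePairing {L : C} (ω : L ⊗ L ⟶ 𝟙_ C) : Prop :=
  ∃ p : ExactPairing L L, @ExactPairing.evaluation C _ _ L L p = ω

variable (C) in
/-- A (finite) ribbon category is modular if the Hopf pairing `ω` of its coend
`L = ∫^X X* ⊗ X` is non-degenerate. Here `ω` is the pairing whose composition with the universal
dinatural maps `ι_X ⊗ ι_Y` is `hopfPairingComponent X Y`. -/
def IsModular : Prop :=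
  ∃ (_ : HasCoend (innerHom C)) (ω : coend (innerHom C) ⊗ coend (innerHom C) ⟶ 𝟙_ C),
    (∀ X Y : C, (coend.ι (innerHom C) X ⊗ₘ coend.ι (innerHom C) Y) ≫ ω =
      hopfPairingComponent X Y) ∧
    IsNondegeneratePairing ω

end Modular

/-! ### The linear structure on the Drinfeld centre -/

section Center

variable {C : Type u} [Category.{v} C] [MonoidalCategory C] [Preadditive C]
  [MonoidalPreadditive C]

instance (X Y : Center C) : Zero (X ⟶ Y) := ⟨⟨0, fun U => by simp⟩⟩

instance (X Y : Center C) : Add (X ⟶ Y) :=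
  ⟨fun f g => ⟨f.f + g.f, fun U => by
    simp only [MonoidalPreadditive.add_whiskerRight, MonoidalPreadditive.whiskerLeft_add,
      Preadditive.add_comp, Preadditive.comp_add, Center.Hom.comm]⟩⟩

instance (X Y : Center C) : Neg (X ⟶ Y) :=
  ⟨fun f => ⟨-f.f, fun U => by
    have h₁ : (-f.f) ▷ U = -(f.f ▷ U) := (tensorRight U).map_neg
    have h₂ : U ◁ (-f.f) = -(U ◁ f.f) := (tensorLeft U).map_neg
    rw [h₁, h₂, Preadditive.neg_comp, Preadditive.comp_neg, Center.Hom.comm]⟩⟩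

/-- Sums of morphisms in the Drinfeld centre are computed in `C`. -/
instance centerPreadditive : Preadditive (Center C) where
  homGroup X Y :=
    { add_assoc := fun f g h => Center.ext _ _ (add_assoc f.f g.f h.f)
      zero_add := fun f => Center.ext _ _ (zero_add f.f)
      add_zero := fun f => Center.ext _ _ (add_zero f.f)
      neg_add_cancel := fun f => Center.ext _ _ (neg_add_cancel f.f)
      add_comm := fun f g => Center.ext _ _ (add_comm f.f g.f)
      nsmul := nsmulRec
      zsmul := zsmulRec }
  add_comp X Y Z f f' g := Center.ext _ _ (Preadditive.add_comp _ _ _ f.f f'.f g.f)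
  comp_add X Y Z f g g' := Center.ext _ _ (Preadditive.comp_add _ _ _ f.f g.f g'.f)

/-- Scalar multiples of morphisms in the Drinfeld centre are computed in `C`. -/
instance centerLinear (k : Type w) [Field k] [Linear k C] [MonoidalLinear k C] :
    Linear k (Center C) where
  homModule X Y :=
    { smul := fun r f => ⟨r • f.f, fun U => by simp⟩
      one_smul := fun f => Center.ext _ _ (one_smul k f.f)
      mul_smul := fun r s f => Center.ext _ _ (mul_smul r s f.f)
      smul_zero := fun r => Center.ext _ _ (smul_zero r)
      smul_add := fun r f g => Center.ext _ _ (smul_add r f.f g.f)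
      add_smul := fun r s f => Center.ext _ _ (add_smul r s f.f)
      zero_smul := fun f => Center.ext _ _ (zero_smul k f.f) }
  smul_comp X Y Z r f g := Center.ext _ _ (Linear.smul_comp _ _ _ r f.f g.f)
  comp_smul X Y Z f r g := Center.ext _ _ (Linear.comp_smul _ _ _ f.f r g.f)

end Center

/-! ### The central monad -/

section CentralMonad

variable (C : Type u) [Category.{v} C] [MonoidalCategory C] [RigidCategory C]

/-- All the coends `∫^X X* ⊗ M ⊗ X` exist. -/
abbrev HasCentralCoends : Prop := ∀ M : C, HasCoend ((centralBifunctor C).obj M)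

variable {C} in
lemma tensorLeftHomEquiv_symm_comp_whiskerRight {A X Y N : C} (g : A ⟶ X ⊗ N) (f : X ⟶ Y) :
    (tensorLeftHomEquiv A Y Yᘁ N).symm (g ≫ f ▷ N) =
      rightAdjointMate f ▷ A ≫ (tensorLeftHomEquiv A X Xᘁ N).symm g := by
  simp only [tensorLeftHomEquiv, Equiv.coe_fn_symm_mk]
  have h := rightAdjointMate_comp_evaluation f
  calc _ = Yᘁ ◁ g ⊗≫ (Yᘁ ◁ f ≫ ε_ Y Yᘁ) ▷ N ⊗≫ 𝟙 _ := by monoidal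
    _ = (Yᘁ ◁ g ≫ rightAdjointMate f ▷ (X ⊗ N)) ⊗≫ (ε_ X Xᘁ) ▷ N ⊗≫ 𝟙 _ := by
      rw [← h]; monoidal
    _ = _ := by rw [whisker_exchange]; monoidal

variable [HasCentralCoends C]

/-- The endofunctor `Z(M) = ∫^X X* ⊗ M ⊗ X`. -/
noncomputable def centralFunctor : C ⥤ C where
  obj M := coend ((centralBifunctor C).obj M)
  map f := coend.map ((centralBifunctor C).map f)
  map_id M := by rw [CategoryTheory.Functor.map_id, coend.map_id]
  map_comp f g := by rw [CategoryTheory.Functor.map_comp, coend.map_comp]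

variable {C}

/-- The universal dinatural map `X* ⊗ (M ⊗ X) ⟶ Z(M)`. -/
noncomputable def centralι (M X : C) : Xᘁ ⊗ (M ⊗ X) ⟶ (centralFunctor C).obj M :=
  coend.ι ((centralBifunctor C).obj M) X

/-- The transpose `M ⊗ X ⟶ X ⊗ Z(M)` of the universal dinatural map, under the adjunction
between `X* ⊗ -` and `X ⊗ -`. -/
noncomputable def centralδ (M X : C) : M ⊗ X ⟶ X ⊗ (centralFunctor C).obj M :=
  tensorLeftHomEquiv (M ⊗ X) X Xᘁ _ (centralι M X)


lemma centralδ_naturality (M : C) {X Y : C} (f : X ⟶ Y) :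
    M ◁ f ≫ centralδ M Y = centralδ M X ≫ f ▷ (centralFunctor C).obj M := by
  apply (tensorLeftHomEquiv _ Y Yᘁ _).symm.injective
  rw [tensorLeftHomEquiv_symm_naturality, tensorLeftHomEquiv_symm_comp_whiskerRight]
  simp only [centralδ, Equiv.symm_apply_apply]
  exact (coend.condition ((centralBifunctor C).obj M) f).symm

/-- The morphism out of `Z(M)` corresponding to a natural family `M ⊗ X ⟶ X ⊗ N`. -/
noncomputable def centralDesc {M N : C} (φ : ∀ X, M ⊗ X ⟶ X ⊗ N)
    (hφ : ∀ (X Y : C) (f : X ⟶ Y), M ◁ f ≫ φ Y = φ X ≫ f ▷ N) :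
    (centralFunctor C).obj M ⟶ N :=
  coend.desc (F := (centralBifunctor C).obj M)
    (fun X => (tensorLeftHomEquiv (M ⊗ X) X Xᘁ N).symm (φ X)) (fun X Y f => by
      have h := tensorLeftHomEquiv_symm_comp_whiskerRight (φ X) f
      rw [← hφ X Y f, tensorLeftHomEquiv_symm_naturality] at h
      exact h.symm)

lemma centralδ_desc {M N : C} (φ : ∀ X, M ⊗ X ⟶ X ⊗ N)
    (hφ : ∀ (X Y : C) (f : X ⟶ Y), M ◁ f ≫ φ Y = φ X ≫ f ▷ N) (X : C) :
    centralδ M X ≫ X ◁ centralDesc φ hφ = φ X := by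
  rw [centralδ, ← tensorLeftHomEquiv_naturality, ← Equiv.eq_symm_apply]
  exact coend.ι_desc _ _ X

lemma central_hom_ext {M N : C} {f g : (centralFunctor C).obj M ⟶ N}
    (h : ∀ X, centralδ M X ≫ X ◁ f = centralδ M X ≫ X ◁ g) : f = g := by
  apply coend.hom_ext
  intro X
  have h' := h X
  rw [centralδ, ← tensorLeftHomEquiv_naturality, ← tensorLeftHomEquiv_naturality,
    EmbeddingLike.apply_eq_iff_eq] at h'
  exact h'

lemma centralδ_map {M N : C} (f : M ⟶ N) (X : C) :
    centralδ M X ≫ X ◁ (centralFunctor C).map f = f ▷ X ≫ centralδ N X := by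
  rw [centralδ, ← tensorLeftHomEquiv_naturality, ← Equiv.eq_symm_apply,
    tensorLeftHomEquiv_symm_naturality, centralδ, Equiv.symm_apply_apply]
  exact coend.ι_map ((centralBifunctor C).map f) X

lemma central_tensor_comp {M Y N : C} (X : C)
    (d : (centralFunctor C).obj M ⊗ Y ⟶ N) :
    centralδ M X ▷ Y ≫ (α_ _ _ _).hom ≫ X ◁ d =
      (tensorRightHomEquiv _ Y Yᘁ _).symm
        (centralδ M X ≫ X ◁ (tensorRightHomEquiv _ Y Yᘁ _ d) ≫ (α_ _ _ _).inv) := by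
  rw [tensorRightHomEquiv_symm_naturality]
  congr 1
  obtain ⟨e, rfl⟩ := (tensorRightHomEquiv _ Y Yᘁ _).symm.surjective d
  rw [Equiv.apply_symm_apply]
  simp only [tensorRightHomEquiv, Equiv.coe_fn_symm_mk]
  monoidal

/-- The morphism out of `Z(M) ⊗ Y` corresponding to a natural family
`(M ⊗ X) ⊗ Y ⟶ X ⊗ N`. -/
noncomputable def centralTensorDesc {M Y N : C} (ψ : ∀ X, (M ⊗ X) ⊗ Y ⟶ X ⊗ N)
    (hψ : ∀ (X X' : C) (f : X ⟶ X'), (M ◁ f) ▷ Y ≫ ψ X' = ψ X ≫ f ▷ N) :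
    (centralFunctor C).obj M ⊗ Y ⟶ N :=
  (tensorRightHomEquiv _ Y Yᘁ _).symm
    (centralDesc (fun X => tensorRightHomEquiv _ Y Yᘁ _ (ψ X) ≫ (α_ _ _ _).hom) (by
      intro X X' f
      have h : M ◁ f ≫ tensorRightHomEquiv _ Y Yᘁ _ (ψ X') =
          tensorRightHomEquiv _ Y Yᘁ _ (ψ X) ≫ (f ▷ N) ▷ Yᘁ := by
        apply (tensorRightHomEquiv _ Y Yᘁ _).symm.injective
        rw [tensorRightHomEquiv_symm_naturality, ← tensorRightHomEquiv_naturality,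
          Equiv.symm_apply_apply, Equiv.symm_apply_apply, hψ X X' f]
      rw [reassoc_of% h]
      simp))

lemma centralδ_tensorDesc {M Y N : C} (ψ : ∀ X, (M ⊗ X) ⊗ Y ⟶ X ⊗ N)
    (hψ : ∀ (X X' : C) (f : X ⟶ X'), (M ◁ f) ▷ Y ≫ ψ X' = ψ X ≫ f ▷ N) (X : C) :
    centralδ M X ▷ Y ≫ (α_ _ _ _).hom ≫ X ◁ centralTensorDesc ψ hψ = ψ X := by
  rw [central_tensor_comp, centralTensorDesc, Equiv.apply_symm_apply, reassoc_of% centralδ_desc]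
  simp

lemma central_tensor_hom_ext {M Y N : C} {f g : (centralFunctor C).obj M ⊗ Y ⟶ N}
    (h : ∀ X, centralδ M X ▷ Y ≫ (α_ _ _ _).hom ≫ X ◁ f =
      centralδ M X ▷ Y ≫ (α_ _ _ _).hom ≫ X ◁ g) : f = g := by
  apply (tensorRightHomEquiv _ Y Yᘁ _).injective
  apply central_hom_ext
  intro X
  have h' := h X
  rw [central_tensor_comp, central_tensor_comp, EmbeddingLike.apply_eq_iff_eq] at h'
  simpa only [← Category.assoc, cancel_mono] using h'

/-- The natural family `Z(M) ⊗ Y ⟶ Y ⊗ Z(M)` whose composite with `centralδ M X` is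
`centralδ M (X ⊗ Y)`. -/
noncomputable def centralBraid (M Y : C) :
    (centralFunctor C).obj M ⊗ Y ⟶ Y ⊗ (centralFunctor C).obj M :=
  centralTensorDesc
    (fun X => (α_ _ _ _).hom ≫ centralδ M (X ⊗ Y) ≫ (α_ _ _ _).hom) (by
      intro X X' f
      have h := centralδ_naturality M (f ▷ Y)
      simp [reassoc_of% h])

lemma centralδ_centralBraid (M X Y : C) :
    centralδ M X ▷ Y ≫ (α_ _ _ _).hom ≫ X ◁ centralBraid M Y =
      (α_ _ _ _).hom ≫ centralδ M (X ⊗ Y) ≫ (α_ _ _ _).hom :=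
  centralδ_tensorDesc _ _ X

lemma centralBraid_naturality (M : C) {Y Y' : C} (f : Y ⟶ Y') :
    (centralFunctor C).obj M ◁ f ≫ centralBraid M Y' =
      centralBraid M Y ≫ f ▷ (centralFunctor C).obj M := by
  apply central_tensor_hom_ext
  intro X
  have h := centralδ_naturality M (X ◁ f)
  have e := centralδ_centralBraid M X Y'
  have e' := centralδ_centralBraid M X Y
  calc _ = (M ⊗ X) ◁ f ≫ centralδ M X ▷ Y' ≫ (α_ _ _ _).hom ≫ X ◁ centralBraid M Y' := by
        rw [whisker_exchange_assoc]; simp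
    _ = (α_ _ _ _).hom ≫ (M ◁ X ◁ f ≫ centralδ M (X ⊗ Y')) ≫ (α_ _ _ _).hom := by
        rw [e]; simp
    _ = ((α_ _ _ _).hom ≫ centralδ M (X ⊗ Y) ≫ (α_ _ _ _).hom) ≫
          X ◁ f ▷ (centralFunctor C).obj M := by
        rw [h]; simp
    _ = _ := by rw [← e']; simp

/-- The unit `M ≅ 𝟙* ⊗ M ⊗ 𝟙 ⟶ Z(M)` of the central monad. -/
noncomputable def centralUnit (M : C) : M ⟶ (centralFunctor C).obj M :=
  (ρ_ M).inv ≫ centralδ M (𝟙_ C) ≫ (λ_ _).hom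

/-- The multiplication of the central monad. On the component of `Z(Z(M))` indexed by `X` (inner)
and `Y` (outer), it is the map
`Y* ⊗ (X* ⊗ M ⊗ X) ⊗ Y ≅ (X ⊗ Y)* ⊗ M ⊗ (X ⊗ Y) ⟶ Z(M)`; see `centralδ_mul` and
`centralδ_centralBraid` for the transposed form of this property. -/
noncomputable def centralMul (M : C) :
    (centralFunctor C).obj ((centralFunctor C).obj M) ⟶ (centralFunctor C).obj M :=
  centralDesc (centralBraid M) (fun _ _ f => centralBraid_naturality M f)

lemma centralδ_mul (M Y : C) :
    centralδ ((centralFunctor C).obj M) Y ≫ Y ◁ centralMul M = centralBraid M Y :=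
  centralδ_desc _ _ Y

/-- The characterization of the multiplication by its composites with the (transposed) universal
dinatural maps: `(δ_X ⊗ Y) ≫ (X ⊗ δ_Y) ≫ (X ⊗ Y ⊗ μ) = δ_{X ⊗ Y}` up to associators. -/
lemma centralδ_centralδ_mul (M X Y : C) :
    centralδ M X ▷ Y ≫ (α_ _ _ _).hom ≫ X ◁ centralδ ((centralFunctor C).obj M) Y ≫
      X ◁ Y ◁ centralMul M =
    (α_ _ _ _).hom ≫ centralδ M (X ⊗ Y) ≫ (α_ _ _ _).hom := by
  rw [← MonoidalCategory.whiskerLeft_comp, centralδ_mul, centralδ_centralBraid]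

lemma centralBraid_map {M N : C} (f : M ⟶ N) (Y : C) :
    (centralFunctor C).map f ▷ Y ≫ centralBraid N Y =
      centralBraid M Y ≫ Y ◁ (centralFunctor C).map f := by
  apply central_tensor_hom_ext
  intro X
  have e := centralδ_centralBraid M X Y
  have e' := centralδ_centralBraid N X Y
  have h := centralδ_map f X
  have h' := centralδ_map f (X ⊗ Y)
  calc _ = (centralδ M X ≫ X ◁ (centralFunctor C).map f) ▷ Y ≫ (α_ _ _ _).hom ≫
          X ◁ centralBraid N Y := by simp
    _ = (f ▷ X) ▷ Y ≫ (α_ _ _ _).hom ≫ centralδ N (X ⊗ Y) ≫ (α_ _ _ _).hom := by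
        rw [h, comp_whiskerRight, Category.assoc, e']
    _ = (α_ _ _ _).hom ≫ (f ▷ (X ⊗ Y) ≫ centralδ N (X ⊗ Y)) ≫ (α_ _ _ _).hom := by simp
    _ = ((α_ _ _ _).hom ≫ centralδ M (X ⊗ Y) ≫ (α_ _ _ _).hom) ≫
          X ◁ Y ◁ (centralFunctor C).map f := by rw [← h']; simp
    _ = _ := by rw [← e]; simp

/-- `centralBraid` is multiplicative. -/
lemma centralBraid_tensor (M Y W : C) :
    centralBraid M Y ▷ W ≫ (α_ _ _ _).hom ≫ Y ◁ centralBraid M W =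
      (α_ _ _ _).hom ≫ centralBraid M (Y ⊗ W) ≫ (α_ _ _ _).hom := by
  rw [← cancel_epi (α_ _ _ _).inv]
  apply central_tensor_hom_ext
  intro X
  have e1 := centralδ_centralBraid M X Y
  have e2 := centralδ_centralBraid M (X ⊗ Y) W
  have e3 := centralδ_centralBraid M X (Y ⊗ W)
  have n := centralδ_naturality M (α_ X Y W).hom
  calc _ = (α_ _ _ _).inv ≫ (centralδ M X ▷ Y ≫ (α_ _ _ _).hom ≫ X ◁ centralBraid M Y) ▷ W ≫
          (α_ _ _ _).hom ≫ X ◁ (α_ _ _ _).hom ≫ X ◁ Y ◁ centralBraid M W := by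
        simp
    _ = (α_ _ _ _).inv ≫ (α_ _ _ _).hom ▷ W ≫ (centralδ M (X ⊗ Y) ▷ W ≫ (α_ _ _ _).hom ≫
          (X ⊗ Y) ◁ centralBraid M W) ≫ (α_ _ _ _).hom := by
        rw [e1]; simp
    _ = (α_ _ _ _).inv ≫ (α_ _ _ _).hom ▷ W ≫ (α_ _ _ _).hom ≫
          (centralδ M ((X ⊗ Y) ⊗ W) ≫ (α_ X Y W).hom ▷ _) ≫
          (α_ _ _ _).hom ≫ X ◁ (α_ _ _ _).hom := by
        rw [e2]; simp
    _ = (centralδ M X ▷ (Y ⊗ W) ≫ (α_ _ _ _).hom ≫ X ◁ centralBraid M (Y ⊗ W)) ≫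
          X ◁ (α_ _ _ _).hom := by
        rw [← n, e3]; simp
    _ = _ := by simp

lemma centralBraid_unit (M : C) : centralBraid M (𝟙_ C) = (ρ_ _).hom ≫ (λ_ _).inv := by
  apply central_tensor_hom_ext
  intro X
  have n := centralδ_naturality M (ρ_ X).hom
  rw [centralδ_centralBraid]
  calc _ = (α_ _ _ _).hom ≫ (centralδ M (X ⊗ 𝟙_ C) ≫ (ρ_ X).hom ▷ _) ≫ X ◁ (λ_ _).inv := by
        have t : (ρ_ X).hom ▷ (centralFunctor C).obj M ≫ X ◁ (λ_ ((centralFunctor C).obj M)).inv =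
            (α_ _ _ _).hom := by
          rw [← MonoidalCategory.triangle, Category.assoc, ← MonoidalCategory.whiskerLeft_comp]
          simp
        rw [Category.assoc, t]
    _ = _ := by rw [← n]; simp

lemma centralUnit_naturality {M N : C} (f : M ⟶ N) :
    f ≫ centralUnit N = centralUnit M ≫ (centralFunctor C).map f := by
  have h := centralδ_map f (𝟙_ C)
  calc _ = (ρ_ M).inv ≫ (f ▷ 𝟙_ C ≫ centralδ N (𝟙_ C)) ≫ (λ_ _).hom := by simp [centralUnit]
    _ = _ := by rw [← h]; simp [centralUnit]

lemma centralMul_naturality {M N : C} (f : M ⟶ N) :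
    (centralFunctor C).map ((centralFunctor C).map f) ≫ centralMul N =
      centralMul M ≫ (centralFunctor C).map f := by
  apply central_hom_ext
  intro Y
  rw [MonoidalCategory.whiskerLeft_comp, reassoc_of% centralδ_map, centralδ_mul,
    MonoidalCategory.whiskerLeft_comp, reassoc_of% centralδ_mul, centralBraid_map]

lemma centralUnit_mul (M : C) :
    centralUnit ((centralFunctor C).obj M) ≫ centralMul M = 𝟙 _ := by
  have h := centralδ_mul M (𝟙_ C)
  rw [centralBraid_unit] at h
  calc _ = (ρ_ _).inv ≫ (centralδ ((centralFunctor C).obj M) (𝟙_ C) ≫ 𝟙_ C ◁ centralMul M) ≫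
        (λ_ _).hom := by simp [centralUnit]
    _ = _ := by rw [h]; simp

lemma map_centralUnit_mul (M : C) :
    (centralFunctor C).map (centralUnit M) ≫ centralMul M = 𝟙 _ := by
  apply central_hom_ext
  intro X
  have n := centralδ_naturality M (λ_ X).hom
  have e := centralδ_centralBraid M (𝟙_ C) X
  rw [MonoidalCategory.whiskerLeft_comp, reassoc_of% centralδ_map, centralδ_mul]
  calc _ = (ρ_ M).inv ▷ X ≫ (centralδ M (𝟙_ C) ▷ X ≫ (α_ _ _ _).hom ≫
          𝟙_ C ◁ centralBraid M X) ≫ (λ_ _).hom := by simp [centralUnit]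
    _ = (ρ_ M).inv ▷ X ≫ (α_ _ _ _).hom ≫ centralδ M (𝟙_ C ⊗ X) ≫ (λ_ X).hom ▷ _ := by
        rw [e]; simp
    _ = _ := by rw [← n]; simp

lemma centralMul_assoc (M : C) :
    (centralFunctor C).map (centralMul M) ≫ centralMul M =
      centralMul ((centralFunctor C).obj M) ≫ centralMul M := by
  apply central_hom_ext
  intro Y
  rw [MonoidalCategory.whiskerLeft_comp, MonoidalCategory.whiskerLeft_comp, reassoc_of% centralδ_map,
    centralδ_mul, reassoc_of% centralδ_mul]
  apply central_tensor_hom_ext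
  intro X
  calc _ = (centralδ ((centralFunctor C).obj M) X ≫ X ◁ centralMul M) ▷ Y ≫ (α_ _ _ _).hom ≫
          X ◁ centralBraid M Y := by simp
    _ = (α_ _ _ _).hom ≫ (centralδ ((centralFunctor C).obj M) (X ⊗ Y) ≫
          (X ⊗ Y) ◁ centralMul M) ≫ (α_ _ _ _).hom := by
        rw [centralδ_mul, centralδ_mul, centralBraid_tensor]
    _ = (centralδ ((centralFunctor C).obj M) X ▷ Y ≫ (α_ _ _ _).hom ≫
          X ◁ centralBraid ((centralFunctor C).obj M) Y) ≫ X ◁ Y ◁ centralMul M := by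
        rw [centralδ_centralBraid]; simp
    _ = _ := by simp

variable (C) in
/-- The central monad `Z(M) = ∫^X X* ⊗ M ⊗ X`. -/
@[simps!]
noncomputable def centralMonad : Monad C where
  toFunctor := centralFunctor C
  η := { app := centralUnit
         naturality := fun _ _ f => centralUnit_naturality f }
  μ := { app := centralMul
         naturality := fun _ _ f => centralMul_naturality f }
  assoc := centralMul_assoc
  left_unit := centralUnit_mul
  right_unit := map_centralUnit_mul

end CentralMonad

end ModularTensor

/-! The left adjoint exists in any rigid category with central coends. Maps `Z(M) ⟶ N` are natural
families `M ⊗ X ⟶ X ⊗ N`, so a half-braiding on `X` is the same as an action `Z(X) ⟶ X`, and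
morphisms of the centre are exactly the morphisms of `Z`-modules. Hence `M ↦ Z(M)`, with
half-braiding `centralBraid`, is the free module functor, left adjoint to `U` with monad `Z`. The
coends exist because the braiding turns `X* ⊗ M ⊗ X` into `X* ⊗ X ⊗ M`, and `- ⊗ M`, having a right
adjoint, preserves the coend `L`. This gives `Z(M) ≅ L ⊗ M` (`centralIso`).

For the other adjunction, `Z` is shown to be a Frobenius monad. The inverse twist defines a form `λ
: Z(N) ⟶ N`. On the components indexed by `X` and `Y`, the composite of the multiplication with `λ`
involves the inverse twist of `X ⊗ Y`. By the balancing axiom this is the inverse double braiding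
with inverse twists on both factors, which is the Hopf pairing `ω` with the automorphism of `L`
induced by the inverse twist inserted on both legs (`centralMul_frobeniusForm`). Non-degeneracy of
`ω` therefore makes `f ↦ Z(f) ≫ μ ≫ λ` a bijection from maps `X ⟶ Z(N)` to maps `Z(X) ⟶ N`.
Restricted to module maps, it becomes the bijection `f ↦ f ≫ λ` from `Hom(X, F(N))` to `Hom(U(X),
N)` (`forgetHom_bijective`). -/

namespace ModularTensor

/-! ### The central coends of a braided rigid category -/

section CentralCoends

variable {C : Type u} [Category.{v} C] [MonoidalCategory C] [RigidCategory C]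
  [HasCoend (innerHom C)]

variable (C) in
/-- The coend `L = ∫^X X* ⊗ X`. -/
noncomputable abbrev coendObj : C := coend (innerHom C)

/-- The universal dinatural map `X* ⊗ X ⟶ L`. -/
noncomputable def coendι (X : C) : Xᘁ ⊗ X ⟶ coendObj C := coend.ι (innerHom C) X

/-- The transpose `X ⟶ X ⊗ L` of the universal dinatural map: the universal coaction. -/
noncomputable def coendδ (X : C) : X ⟶ X ⊗ coendObj C :=
  tensorLeftHomEquiv X X Xᘁ _ (coendι X)

lemma coendι_condition {X Y : C} (f : X ⟶ Y) :
    rightAdjointMate f ▷ X ≫ coendι X = Yᘁ ◁ f ≫ coendι Y :=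
  coend.condition (innerHom C) f

/-- The morphism out of `L` induced by a dinatural family `X* ⊗ X ⟶ N`. -/
noncomputable def coendDesc {N : C} (s : ∀ X : C, Xᘁ ⊗ X ⟶ N)
    (hs : ∀ (X Y : C) (f : X ⟶ Y), rightAdjointMate f ▷ X ≫ s X = (Yᘁ : C) ◁ f ≫ s Y) :
    coendObj C ⟶ N :=
  coend.desc (F := innerHom C) s hs

lemma coendι_desc {N : C} (s : ∀ X : C, Xᘁ ⊗ X ⟶ N)
    (hs : ∀ (X Y : C) (f : X ⟶ Y), rightAdjointMate f ▷ X ≫ s X = (Yᘁ : C) ◁ f ≫ s Y) (X : C) :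
    coendι X ≫ coendDesc s hs = s X :=
  coend.ι_desc (F := innerHom C) _ _ X

lemma coend_hom_ext {N : C} {f g : coendObj C ⟶ N}
    (h : ∀ X, coendι X ≫ f = coendι X ≫ g) : f = g :=
  coend.hom_ext h

/-- Since `- ⊗ M` is left adjoint to `- ⊗ M*`, it keeps the universal maps of `L` jointly epic. -/
lemma coend_tensor_hom_ext {M N : C} {f g : coendObj C ⊗ M ⟶ N}
    (h : ∀ X, coendι X ▷ M ≫ f = coendι X ▷ M ≫ g) : f = g := by
  apply (tensorRightHomEquiv _ M Mᘁ _).injective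
  apply coend_hom_ext
  intro X
  apply (tensorRightHomEquiv _ M Mᘁ _).symm.injective
  rw [tensorRightHomEquiv_symm_naturality, tensorRightHomEquiv_symm_naturality,
    Equiv.symm_apply_apply, Equiv.symm_apply_apply, h X]

variable [BraidedCategory C]

/-- The dinatural map `X* ⊗ (M ⊗ X) ⟶ L ⊗ M`. -/
noncomputable def centralComparisonι (M X : C) : Xᘁ ⊗ (M ⊗ X) ⟶ coendObj C ⊗ M :=
  Xᘁ ◁ (β_ X M).inv ≫ (α_ _ _ _).inv ≫ coendι X ▷ M

lemma centralComparisonι_condition (M : C) {X Y : C} (f : X ⟶ Y) :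
    rightAdjointMate f ▷ (M ⊗ X) ≫ centralComparisonι M X =
      Yᘁ ◁ (M ◁ f) ≫ centralComparisonι M Y := by
  have h : M ◁ f ≫ (β_ Y M).inv = (β_ X M).inv ≫ f ▷ M := by simp
  calc _ = Yᘁ ◁ (β_ X M).inv ≫ (α_ _ _ _).inv ≫ (rightAdjointMate f ▷ X ≫ coendι X) ▷ M := by
        rw [centralComparisonι, ← whisker_exchange_assoc]; simp
    _ = Yᘁ ◁ ((β_ X M).inv ≫ f ▷ M) ≫ (α_ _ _ _).inv ≫ coendι Y ▷ M := by
        rw [coendι_condition]; simp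
    _ = _ := by
        rw [← h, centralComparisonι, MonoidalCategory.whiskerLeft_comp, Category.assoc]

/-- The cowedge `X* ⊗ (M ⊗ X) ⟶ L ⊗ M`. -/
noncomputable def centralCowedge (M : C) : Cowedge ((centralBifunctor C).obj M) :=
  Cowedge.mk (coendObj C ⊗ M) (centralComparisonι M)
    (fun _ _ f => centralComparisonι_condition M f)

/-- The map out of `L ⊗ M` induced by a dinatural family `X* ⊗ (M ⊗ X) ⟶ N`. -/
noncomputable def centralCowedgeDesc {M N : C} (s : ∀ X : C, Xᘁ ⊗ (M ⊗ X) ⟶ N)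
    (hs : ∀ {X Y : C} (f : X ⟶ Y), rightAdjointMate f ▷ (M ⊗ X) ≫ s X = (Yᘁ : C) ◁ (M ◁ f) ≫ s Y) :
    coendObj C ⊗ M ⟶ N :=
  -- The braiding moves `M` to the right, where it can be transposed to `M*` on the target; the
  -- universal property of `L` then applies.
  (tensorRightHomEquiv _ M Mᘁ _).symm (coendDesc
    (fun X => tensorRightHomEquiv _ M Mᘁ _ ((α_ _ _ _).hom ≫ (Xᘁ : C) ◁ (β_ X M).hom ≫ s X)) (by
      intro X Y f
      apply (tensorRightHomEquiv _ M Mᘁ _).symm.injective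
      rw [tensorRightHomEquiv_symm_naturality, tensorRightHomEquiv_symm_naturality,
        Equiv.symm_apply_apply, Equiv.symm_apply_apply]
      calc _ = (α_ _ _ _).hom ≫ (Yᘁ : C) ◁ (β_ X M).hom ≫ rightAdjointMate f ▷ (M ⊗ X) ≫ s X := by
            rw [whisker_exchange_assoc]; simp
        _ = (α_ _ _ _).hom ≫ (Yᘁ : C) ◁ ((β_ X M).hom ≫ M ◁ f) ≫ s Y := by
            rw [hs]; simp
        _ = _ := by
            rw [← BraidedCategory.braiding_naturality_left]
            simp [-BraidedCategory.braiding_naturality_left]))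

lemma centralCowedgeDesc_fac {M N : C} (s : ∀ X : C, Xᘁ ⊗ (M ⊗ X) ⟶ N)
    (hs : ∀ {X Y : C} (f : X ⟶ Y), rightAdjointMate f ▷ (M ⊗ X) ≫ s X = (Yᘁ : C) ◁ (M ◁ f) ≫ s Y)
    (X : C) : coendι X ▷ M ≫ centralCowedgeDesc s hs =
      (α_ _ _ _).hom ≫ (Xᘁ : C) ◁ (β_ X M).hom ≫ s X := by
  rw [centralCowedgeDesc, ← tensorRightHomEquiv_symm_naturality, Equiv.symm_apply_eq]
  exact coendι_desc _ _ X

lemma centralComparisonι_desc {M N : C} (s : ∀ X : C, Xᘁ ⊗ (M ⊗ X) ⟶ N)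
    (hs : ∀ {X Y : C} (f : X ⟶ Y), rightAdjointMate f ▷ (M ⊗ X) ≫ s X = (Yᘁ : C) ◁ (M ◁ f) ≫ s Y)
    (X : C) : centralComparisonι M X ≫ centralCowedgeDesc s hs = s X := by
  rw [centralComparisonι, Category.assoc, Category.assoc, centralCowedgeDesc_fac]
  simp only [Iso.inv_hom_id_assoc, whiskerLeft_inv_hom_assoc]

lemma centralComparisonι_hom_ext {M N : C} {f g : coendObj C ⊗ M ⟶ N}
    (h : ∀ X, centralComparisonι M X ≫ f = centralComparisonι M X ≫ g) : f = g := by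
  apply coend_tensor_hom_ext
  intro X
  simpa only [centralComparisonι, Category.assoc, cancel_epi] using h X

/-- `L ⊗ M` is the coend `∫^X X* ⊗ M ⊗ X`. -/
noncomputable def centralCowedgeIsColimit (M : C) : IsColimit (centralCowedge M) :=
  Multicofork.IsColimit.mk _
    (fun E => centralCowedgeDesc (fun X : C => E.π X) (fun f => Cowedge.condition E f))
    (fun E X => centralComparisonι_desc (fun X : C => E.π X) (fun f => Cowedge.condition E f) X)
    (fun E _ hm => centralComparisonι_hom_ext (fun X => (hm X).trans
      (centralComparisonι_desc (fun X : C => E.π X) (fun f => Cowedge.condition E f) X).symm))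

instance hasCentralCoends : HasCentralCoends C :=
  fun M => ⟨⟨⟨_, centralCowedgeIsColimit M⟩⟩⟩

/-- The isomorphism `Z(M) ≅ L ⊗ M`. -/
noncomputable def centralIso (M : C) : (centralFunctor C).obj M ≅ coendObj C ⊗ M :=
  (colimit.isColimit _).coconePointUniqueUpToIso (centralCowedgeIsColimit M)

lemma centralι_iso (M X : C) : centralι M X ≫ (centralIso M).hom = centralComparisonι M X :=
  (colimit.isColimit _).comp_coconePointUniqueUpToIso_hom (centralCowedgeIsColimit M)
    (WalkingMultispan.right X)

/-- The transposed form of `centralι_iso`. Later computations test maps against `centralδ` rather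
than against the coend maps, which keeps duals out of them. -/
lemma centralδ_iso (M X : C) : centralδ M X ≫ X ◁ (centralIso M).hom =
    (β_ X M).inv ≫ coendδ X ▷ M ≫ (α_ _ _ _).hom := by
  rw [centralδ, ← tensorLeftHomEquiv_naturality, centralι_iso, ← Equiv.eq_symm_apply,
    tensorLeftHomEquiv_symm_naturality]
  rw [centralComparisonι]
  congr 1
  obtain ⟨e, he⟩ : ∃ e, e = coendδ X := ⟨_, rfl⟩
  have : coendι X = (tensorLeftHomEquiv X X Xᘁ _).symm e := by rw [he, coendδ]; simp
  rw [← he, this]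
  simp only [tensorLeftHomEquiv, Equiv.coe_fn_symm_mk]
  monoidal

lemma centralIso_naturality {M N : C} (f : M ⟶ N) :
    (centralFunctor C).map f ≫ (centralIso N).hom = (centralIso M).hom ≫ _ ◁ f := by
  apply central_hom_ext
  intro X
  rw [MonoidalCategory.whiskerLeft_comp, reassoc_of% centralδ_map, centralδ_iso,
    MonoidalCategory.whiskerLeft_comp, reassoc_of% centralδ_iso]
  calc _ = (f ▷ X ≫ (β_ X N).inv) ≫ coendδ X ▷ N ≫ (α_ _ _ _).hom := by simp
    _ = (β_ X M).inv ≫ (X ◁ f ≫ coendδ X ▷ N) ≫ (α_ _ _ _).hom := by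
        have h : f ▷ X ≫ (β_ X N).inv = (β_ X M).inv ≫ X ◁ f := by simp
        rw [h]; simp
    _ = _ := by rw [whisker_exchange]; simp

end CentralCoends

/-! ### Half-braidings in rigid categories and the free functor to the centre -/

section HalfBraiding

variable {C : Type u} [Category.{v} C] [MonoidalCategory C]

/-- Multiplicativity makes the component at the unit idempotent up to unitors, and an invertible
idempotent is the identity. -/
lemma halfBraiding_unit (X : Center C) : (X.2.β (𝟙_ C)).hom = (ρ_ _).hom ≫ (λ_ _).inv := by
  have m := X.2.monoidal (𝟙_ C) (𝟙_ C)
  have n := X.2.naturality (λ_ (𝟙_ C)).hom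
  rw [m] at n
  generalize X.2.β (𝟙_ C) = b at n
  have h : (ρ_ X.1).hom ▷ 𝟙_ C ≫ b.hom = (b.hom ≫ (λ_ X.1).hom) ▷ 𝟙_ C ≫ b.hom := by
    calc _ = (α_ _ _ _).hom ≫ X.1 ◁ (λ_ (𝟙_ C)).hom ≫ b.hom := by
          rw [triangle_assoc]
      _ = b.hom ▷ 𝟙_ C ≫ (α_ _ _ _).hom ≫ 𝟙_ C ◁ b.hom ≫ (λ_ _).hom := by
          rw [n, leftUnitor_tensor_hom]; simp only [Category.assoc, Iso.hom_inv_id_assoc]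
      _ = _ := by
          rw [leftUnitor_naturality, leftUnitor_tensor_hom]
          simp only [comp_whiskerRight, Category.assoc, Iso.hom_inv_id_assoc]
  rw [cancel_mono, whiskerRight_iff] at h
  rw [h, Category.assoc, Iso.hom_inv_id, Category.comp_id]

variable [RigidCategory C]

/-- The candidate inverse of the component at `Y` of a half-braiding on `A`, obtained from the
component at the left dual of `Y`. -/
def halfBraidingInv {A : C} (b : ∀ Y, A ⊗ Y ⟶ Y ⊗ A) (Y : C) : Y ⊗ A ⟶ A ⊗ Y :=
  (ρ_ _).inv ≫ (Y ⊗ A) ◁ η_ (ᘁY) Y ≫ (α_ _ _ _).hom ≫ Y ◁ (α_ _ _ _).inv ≫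
    Y ◁ b (ᘁY) ▷ Y ≫ (α_ _ _ _).inv ≫ (α_ _ _ _).inv ▷ Y ≫ (ε_ (ᘁY) Y ▷ A) ▷ Y ≫
    (λ_ _).hom ▷ Y

/-- Duality gives invertibility for free: multiplicativity merges the components at `Y` and at its
left dual into one component at their tensor product, naturality slides the evaluation or
coevaluation through it, and a zig-zag identity remains. -/
lemma isIso_of_monoidal_naturality {A : C} (b : ∀ Y, A ⊗ Y ⟶ Y ⊗ A)
    (nat : ∀ {X Y : C} (f : X ⟶ Y), A ◁ f ≫ b Y = b X ≫ f ▷ A)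
    (tens : ∀ X Y, b X ▷ Y ≫ (α_ _ _ _).hom ≫ X ◁ b Y =
      (α_ _ _ _).hom ≫ b (X ⊗ Y) ≫ (α_ _ _ _).hom)
    (unit : b (𝟙_ C) = (ρ_ _).hom ≫ (λ_ _).inv) (Y : C) : IsIso (b Y) := by
  refine ⟨halfBraidingInv b Y, ?_, ?_⟩
  · have t := tens Y (ᘁY)
    have n := nat (ε_ (ᘁY) Y)
    rw [unit] at n
    calc _ = 𝟙 _ ⊗≫ (b Y ▷ 𝟙_ C ≫ (Y ⊗ A) ◁ η_ (ᘁY) Y) ⊗≫ Y ◁ b (ᘁY) ▷ Y ⊗≫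
          (ε_ (ᘁY) Y ▷ A) ▷ Y ⊗≫ 𝟙 _ := by rw [halfBraidingInv]; monoidal
      _ = 𝟙 _ ⊗≫ (A ⊗ Y) ◁ η_ (ᘁY) Y ⊗≫ (b Y ▷ (ᘁY) ≫ (α_ _ _ _).hom ≫ Y ◁ b (ᘁY)) ▷ Y ⊗≫
          (ε_ (ᘁY) Y ▷ A) ▷ Y ⊗≫ 𝟙 _ := by rw [← whisker_exchange]; monoidal
      _ = 𝟙 _ ⊗≫ (A ⊗ Y) ◁ η_ (ᘁY) Y ⊗≫ (b (Y ⊗ ᘁY) ≫ ε_ (ᘁY) Y ▷ A) ▷ Y ⊗≫ 𝟙 _ := by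
          rw [t]; monoidal
      _ = 𝟙 _ ⊗≫ A ◁ (Y ◁ η_ (ᘁY : C) Y ⊗≫ ε_ (ᘁY : C) Y ▷ Y) ⊗≫ 𝟙 _ := by
          rw [← n]; monoidal
      _ = _ := by rw [ExactPairing.coevaluation_evaluation'']; monoidal
  · have t := tens (ᘁY) Y
    have n := nat (η_ (ᘁY) Y)
    rw [unit] at n
    calc _ = 𝟙 _ ⊗≫ Y ◁ A ◁ η_ (ᘁY) Y ⊗≫ Y ◁ b (ᘁY) ▷ Y ⊗≫
          (ε_ (ᘁY) Y ▷ (A ⊗ Y) ≫ 𝟙_ C ◁ b Y) ⊗≫ 𝟙 _ := by rw [halfBraidingInv]; monoidal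
      _ = 𝟙 _ ⊗≫ Y ◁ A ◁ η_ (ᘁY) Y ⊗≫ Y ◁ (b (ᘁY) ▷ Y ≫ (α_ _ _ _).hom ≫ (ᘁY : C) ◁ b Y) ⊗≫
          ε_ (ᘁY) Y ▷ (Y ⊗ A) ⊗≫ 𝟙 _ := by rw [← whisker_exchange]; monoidal
      _ = 𝟙 _ ⊗≫ Y ◁ (A ◁ η_ (ᘁY) Y ≫ b ((ᘁY : C) ⊗ Y)) ⊗≫ ε_ (ᘁY) Y ▷ (Y ⊗ A) ⊗≫ 𝟙 _ := by
          rw [t]; monoidal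
      _ = 𝟙 _ ⊗≫ (Y ◁ η_ (ᘁY : C) Y ⊗≫ ε_ (ᘁY : C) Y ▷ Y) ▷ A ⊗≫ 𝟙 _ := by
          rw [n]; monoidal
      _ = _ := by rw [ExactPairing.coevaluation_evaluation'']; monoidal

end HalfBraiding

/-! ### The free functor as left adjoint of the forgetful functor, and its monad -/

section FreeCenter

variable {C : Type u} [Category.{v} C] [MonoidalCategory C] [RigidCategory C]
  [HasCentralCoends C]

instance (M Y : C) : IsIso (centralBraid M Y) :=
  isIso_of_monoidal_naturality (centralBraid M) (fun f => centralBraid_naturality M f)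
    (centralBraid_tensor M) (centralBraid_unit M) Y

/-- The half-braiding on `Z(M)`. -/
noncomputable def centralHalfBraiding (M : C) : HalfBraiding ((centralFunctor C).obj M) where
  β Y := asIso (centralBraid M Y)
  monoidal Y W := by
    simp only [asIso_hom]
    rw [← cancel_epi (α_ _ _ _).hom, ← cancel_mono (α_ _ _ _).hom]
    simpa using (centralBraid_tensor M Y W).symm
  naturality f := centralBraid_naturality M f

variable (C) in
/-- The free functor `C ⥤ Z(C)`, sending `M` to `Z(M)` with its canonical half-braiding. -/
noncomputable def freeCenter : C ⥤ Center C where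
  obj M := ⟨(centralFunctor C).obj M, centralHalfBraiding M⟩
  map f := ⟨(centralFunctor C).map f, fun Y => centralBraid_map f Y⟩
  map_id M := Center.ext _ _ ((centralFunctor C).map_id M)
  map_comp f g := Center.ext _ _ ((centralFunctor C).map_comp f g)

/-- The action `Z(X) ⟶ X` of the central monad on an object of the centre. -/
noncomputable def centerAction (X : Center C) : (centralFunctor C).obj X.1 ⟶ X.1 :=
  centralDesc (fun Y => (X.2.β Y).hom) (fun _ _ f => X.2.naturality f)

lemma centralδ_centerAction (X : Center C) (Y : C) :
    centralδ X.1 Y ≫ Y ◁ centerAction X = (X.2.β Y).hom :=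
  centralδ_desc _ _ Y

/-- Tested on `centralδ X.1 W`, both sides are the half-braiding of `X` with `W ⊗ Y`, by its
multiplicativity. Transposed, this is the associativity of the action. -/
lemma centralBraid_centerAction (X : Center C) (Y : C) :
    centralBraid X.1 Y ≫ Y ◁ centerAction X = centerAction X ▷ Y ≫ (X.2.β Y).hom := by
  apply central_tensor_hom_ext
  intro W
  have e := centralδ_centralBraid X.1 W Y
  have h := centralδ_centerAction X
  calc _ = (α_ _ _ _).hom ≫ (centralδ X.1 (W ⊗ Y) ≫ (W ⊗ Y) ◁ centerAction X) ≫
          (α_ _ _ _).hom := by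
        rw [MonoidalCategory.whiskerLeft_comp, ← Category.assoc (α_ _ _ _).hom, ← Category.assoc,
          e]
        simp
    _ = (X.2.β W).hom ▷ Y ≫ (α_ _ _ _).hom ≫ W ◁ (X.2.β Y).hom := by
        rw [h, X.2.monoidal]; simp
    _ = _ := by rw [← h W]; simp

lemma map_centerAction_centerAction (X : Center C) :
    (centralFunctor C).map (centerAction X) ≫ centerAction X =
      centralMul X.1 ≫ centerAction X := by
  apply central_hom_ext
  intro Y
  rw [MonoidalCategory.whiskerLeft_comp, reassoc_of% centralδ_map, centralδ_centerAction,
    MonoidalCategory.whiskerLeft_comp, reassoc_of% centralδ_mul, centralBraid_centerAction]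

lemma centralUnit_centerAction (X : Center C) : centralUnit X.1 ≫ centerAction X = 𝟙 _ := by
  have h := centralδ_centerAction X (𝟙_ C)
  rw [halfBraiding_unit] at h
  calc _ = (ρ_ _).inv ≫ (centralδ X.1 (𝟙_ C) ≫ 𝟙_ C ◁ centerAction X) ≫ (λ_ _).hom := by
        simp [centralUnit]
    _ = _ := by rw [h]; simp

lemma map_comp_centerAction {X Y : Center C} (f : X ⟶ Y) :
    (centralFunctor C).map f.f ≫ centerAction Y = centerAction X ≫ f.f := by
  apply central_hom_ext
  intro W
  rw [MonoidalCategory.whiskerLeft_comp, reassoc_of% centralδ_map, centralδ_centerAction,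
    MonoidalCategory.whiskerLeft_comp, reassoc_of% centralδ_centerAction, f.comm]

/-- A morphism compatible with the actions of the central monad is a morphism in the centre. -/
def centerHomOfAction {X Y : Center C} (f : X.1 ⟶ Y.1)
    (hf : (centralFunctor C).map f ≫ centerAction Y = centerAction X ≫ f) : X ⟶ Y where
  f := f
  comm W := by
    rw [← centralδ_centerAction, ← centralδ_centerAction, ← reassoc_of% centralδ_map,
      ← MonoidalCategory.whiskerLeft_comp, hf, MonoidalCategory.whiskerLeft_comp, Category.assoc]

variable (C) in
/-- The free functor is left adjoint to the forgetful functor of the centre. -/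
noncomputable def freeCenterAdj : freeCenter C ⊣ Center.forget C :=
  Adjunction.mkOfUnitCounit
    { unit :=
        { app := centralUnit
          naturality := fun _ _ f => centralUnit_naturality f }
      counit :=
        -- The half-braiding of `F(M)` is `centralBraid`, so its action is `centralMul` by
        -- definition, and compatibility with the actions is the associativity law.
        { app := fun X => centerHomOfAction (X := (freeCenter C).obj X.1) (centerAction X)
            (map_centerAction_centerAction X)
          naturality := fun _ _ f => Center.ext _ _ (map_comp_centerAction f) }
      left_triangle := by
        ext M
        change (centralFunctor C).map (centralUnit M) ≫ 𝟙 _ ≫ centralMul M = 𝟙 _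
        rw [Category.id_comp, map_centralUnit_mul]
      right_triangle := by
        ext X
        change centralUnit X.1 ≫ 𝟙 _ ≫ centerAction X = 𝟙 _
        rw [Category.id_comp, centralUnit_centerAction] }

variable (C) in
/-- The monad of the free-forgetful adjunction is the central monad. -/
noncomputable def freeCenterAdjMonadIso : (freeCenterAdj C).toMonad ≅ centralMonad C :=
  -- Unit and multiplication of the adjunction monad are `centralUnit` and `centralMul` by
  -- definition, so identities serve as components.
  MonadIso.mk (NatIso.ofComponents (fun _ => Iso.refl _) (fun f => by
      change (centralFunctor C).map f ≫ 𝟙 _ = 𝟙 _ ≫ (centralFunctor C).map f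
      simp))
    (fun M => by
      change centralUnit M ≫ 𝟙 _ = centralUnit M
      simp)
    (fun M => by
      change centralMul M ≫ 𝟙 _ =
        ((centralFunctor C).map (𝟙 _) ≫ 𝟙 _) ≫ centralMul M
      simp)

end FreeCenter

/-! ### Linearity of the free functor -/

section Linear

variable {C : Type u} [Category.{v} C] [MonoidalCategory C] [RigidCategory C]
  [HasCentralCoends C] [Preadditive C] [MonoidalPreadditive C]

instance : (Center.forget C).Additive where
  map_add := rfl

instance : (freeCenter C).Additive where
  map_add {M N f g} := Center.ext _ _ (by
    change (centralFunctor C).map (f + g) = (centralFunctor C).map f + (centralFunctor C).map g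
    apply central_hom_ext
    intro X
    simp only [MonoidalPreadditive.whiskerLeft_add, Preadditive.comp_add, centralδ_map,
      MonoidalPreadditive.add_whiskerRight, Preadditive.add_comp])

instance (k : Type w) [Field k] [Linear k C] [MonoidalLinear k C] : (freeCenter C).Linear k where
  map_smul {M N} f r := Center.ext _ _ (by
    change (centralFunctor C).map (r • f) = r • (centralFunctor C).map f
    apply central_hom_ext
    intro X
    simp only [MonoidalLinear.whiskerLeft_smul, Linear.comp_smul, centralδ_map,
      MonoidalLinear.smul_whiskerRight, Linear.smul_comp])

end Linear

/-! ### The Frobenius form of the central monad -/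

section Twist

variable {C : Type u} [Category.{v} C] [MonoidalCategory C] [RigidCategory C] [BraidedCategory C]
  [RibbonCategory C]

/-- The component of the twist. -/
def twistHom (X : C) : X ⟶ X := (RibbonCategory.twist (C := C)).hom.app X

/-- The inverse twist. -/
def twistInv (X : C) : X ⟶ X := (RibbonCategory.twist (C := C)).inv.app X

lemma twist_twistInv (X : C) :
    twistHom X ≫ twistInv X = 𝟙 X :=
  (RibbonCategory.twist (C := C)).hom_inv_id_app X

lemma twistInv_twist (X : C) :
    twistInv X ≫ twistHom X = 𝟙 X :=
  (RibbonCategory.twist (C := C)).inv_hom_id_app X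

lemma twistInv_naturality {X Y : C} (f : X ⟶ Y) : f ≫ twistInv Y = twistInv X ≫ f :=
  (RibbonCategory.twist (C := C)).inv.naturality f

/-- Invert the balancing axiom, then slide the inverse twists through the two inverse braidings. -/
lemma twistInv_tensor (X Y : C) : twistInv (X ⊗ Y) =
    twistInv X ▷ Y ≫ X ◁ twistInv Y ≫ (β_ Y X).inv ≫ (β_ X Y).inv := by
  have t : twistHom (X ⊗ Y) = (twistHom X ⊗ₘ twistHom Y) ≫ (β_ X Y).hom ≫ (β_ Y X).hom :=
    RibbonCategory.twist_tensor X Y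
  rw [MonoidalCategory.tensorHom_def] at t
  have l : twistInv (X ⊗ Y) ≫ twistHom (X ⊗ Y) = 𝟙 _ := twistInv_twist _
  have r : twistHom (X ⊗ Y) ≫
      ((β_ Y X).inv ≫ (β_ X Y).inv ≫ X ◁ twistInv Y ≫ twistInv X ▷ Y) = 𝟙 _ := by
    rw [t]
    simp only [Category.assoc, Iso.hom_inv_id_assoc]
    rw [← MonoidalCategory.whiskerLeft_comp_assoc, twist_twistInv]
    simp only [MonoidalCategory.whiskerLeft_id, Category.id_comp]
    rw [← comp_whiskerRight, twist_twistInv, id_whiskerRight]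
  calc _ = (β_ Y X).inv ≫ (β_ X Y).inv ≫ X ◁ twistInv Y ≫ twistInv X ▷ Y := by
        rw [← Category.id_comp ((β_ Y X).inv ≫ _), ← l, Category.assoc, r, Category.comp_id]
    _ = _ := by
        rw [whisker_exchange, BraidedCategory.braiding_inv_naturality_right_assoc,
          BraidedCategory.braiding_inv_naturality_left,
          BraidedCategory.braiding_inv_naturality_left_assoc,
          BraidedCategory.braiding_inv_naturality_right_assoc]

end Twist

/-! ### Braiding past an evaluation -/

section Evaluation

variable {C : Type u} [Category.{v} C] [MonoidalCategory C] [RigidCategory C] [BraidedCategory C]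

/-- Braiding `Y` past all of `X* ⊗ X` is trivial after evaluation, so by the hexagon a braiding with
`X*` can be traded for an inverse braiding with `X`. -/
lemma braiding_evaluation (X Y : C) :
    (β_ Xᘁ Y).hom ▷ X ≫ (α_ _ _ _).hom ≫ Y ◁ ε_ X Xᘁ ≫ (ρ_ _).hom =
      (α_ _ _ _).hom ≫ (Xᘁ : C) ◁ (β_ X Y).inv ≫ (α_ _ _ _).inv ≫ ε_ X Xᘁ ▷ Y ≫ (λ_ _).hom := by
  have n := BraidedCategory.braiding_naturality_left (ε_ X Xᘁ) Y
  rw [BraidedCategory.braiding_tensor_left_hom, braiding_tensorUnit_left] at n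
  have n' := congrArg (fun f => (α_ _ _ _).hom ≫ (Xᘁ : C) ◁ (β_ X Y).inv ≫
    (α_ _ _ _).inv ≫ f ≫ (ρ_ _).hom) n
  simpa using n'.symm

end Evaluation

/-! ### Pairings on `L`, the inverse twist and the Frobenius form -/

section Frobenius

variable {C : Type u} [Category.{v} C] [MonoidalCategory C] [RigidCategory C] [HasCoend (innerHom C)]

/-- The endomorphism of `L` induced by a natural endomorphism of the identity functor. -/
noncomputable def coendEnd (t : ∀ X : C, X ⟶ X)
    (ht : ∀ (X Y : C) (f : X ⟶ Y), f ≫ t Y = t X ≫ f) : coendObj C ⟶ coendObj C :=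
  coendDesc (fun X => Xᘁ ◁ t X ≫ coendι X) (fun X Y f => by
    rw [← whisker_exchange_assoc, coendι_condition, ← MonoidalCategory.whiskerLeft_comp_assoc,
      ← MonoidalCategory.whiskerLeft_comp_assoc, ht])

lemma coendι_end (t : ∀ X : C, X ⟶ X) (ht : ∀ (X Y : C) (f : X ⟶ Y), f ≫ t Y = t X ≫ f) (X : C) :
    coendι X ≫ coendEnd t ht = Xᘁ ◁ t X ≫ coendι X :=
  coendι_desc _ _ X

lemma coendδ_end (t : ∀ X : C, X ⟶ X) (ht : ∀ (X Y : C) (f : X ⟶ Y), f ≫ t Y = t X ≫ f) (X : C) :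
    coendδ X ≫ X ◁ coendEnd t ht = t X ≫ coendδ X := by
  rw [coendδ, ← tensorLeftHomEquiv_naturality, coendι_end, ← Equiv.eq_symm_apply,
    tensorLeftHomEquiv_symm_naturality, Equiv.symm_apply_apply]

lemma coendEnd_comp_eq_id (s t : ∀ X : C, X ⟶ X)
    (hs : ∀ (X Y : C) (f : X ⟶ Y), f ≫ s Y = s X ≫ f)
    (ht : ∀ (X Y : C) (f : X ⟶ Y), f ≫ t Y = t X ≫ f) (h : ∀ X, s X ≫ t X = 𝟙 X) :
    coendEnd s hs ≫ coendEnd t ht = 𝟙 _ := by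
  apply coend_hom_ext
  intro X
  rw [reassoc_of% coendι_end, coendι_end, ← MonoidalCategory.whiskerLeft_comp_assoc, h]
  simp

/-- The action `Y ⊗ L ⟶ Y` obtained from the coaction on `Y` and a pairing on `L`. -/
noncomputable def pairingAction (ω : coendObj C ⊗ coendObj C ⟶ 𝟙_ C) (Y : C) :
    Y ⊗ coendObj C ⟶ Y :=
  coendδ Y ▷ _ ≫ (α_ _ _ _).hom ≫ Y ◁ ω ≫ (ρ_ _).hom

variable [BraidedCategory C]

/-- In `hopfPairingComponent Y X`, transposing `Y*` away cancels the evaluation of `Y` by a zig-zag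
and leaves the double braiding of `Y` with `X*`. -/
lemma coendι_pairingAction {ω : coendObj C ⊗ coendObj C ⟶ 𝟙_ C}
    (hω : ∀ X Y : C, (coendι X ⊗ₘ coendι Y) ≫ ω = hopfPairingComponent X Y) (X Y : C) :
    Y ◁ coendι X ≫ pairingAction ω Y = (α_ _ _ _).inv ≫
      ((β_ Y Xᘁ).hom ≫ (β_ Xᘁ Y).hom) ▷ X ≫ (α_ _ _ _).hom ≫ Y ◁ ε_ X Xᘁ ≫ (ρ_ _).hom := by
  have e := hω Y X
  rw [MonoidalCategory.tensorHom_def, hopfPairingComponent, Category.assoc, MonoidalCategory.tensorHom_def' (ε_ Y Yᘁ)] at e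
  calc _ = (Y ◁ coendι X ≫ coendδ Y ▷ _) ≫ (α_ _ _ _).hom ≫ Y ◁ ω ≫ (ρ_ _).hom := by
        rw [pairingAction, Category.assoc]
    _ = 𝟙 _ ⊗≫ η_ Y Yᘁ ▷ (Y ⊗ (Xᘁ ⊗ X)) ⊗≫
          Y ◁ (coendι Y ▷ (Xᘁ ⊗ X) ≫ coendObj C ◁ coendι X ≫ ω) ≫ (ρ_ _).hom := by
        rw [whisker_exchange, coendδ]
        simp only [tensorLeftHomEquiv, Equiv.coe_fn_mk]
        monoidal
    _ = 𝟙 _ ⊗≫ (η_ Y Yᘁ ▷ (Y ⊗ (Xᘁ ⊗ X)) ≫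
          (Y ⊗ Yᘁ) ◁ ((α_ _ _ _).inv ≫ ((β_ Y Xᘁ).hom ≫ (β_ Xᘁ Y).hom) ▷ X ≫
            (α_ _ _ _).hom ≫ Y ◁ ε_ X Xᘁ)) ⊗≫ Y ◁ ε_ Y Yᘁ ⊗≫ 𝟙 _ := by
        rw [e]; monoidal
    _ = 𝟙 _ ⊗≫ ((α_ _ _ _).inv ≫ ((β_ Y Xᘁ).hom ≫ (β_ Xᘁ Y).hom) ▷ X ≫
            (α_ _ _ _).hom ≫ Y ◁ ε_ X Xᘁ) ⊗≫ (η_ Y Yᘁ ▷ Y ⊗≫ Y ◁ ε_ Y Yᘁ) ⊗≫ 𝟙 _ := by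
        rw [← whisker_exchange]; monoidal
    _ = _ := by rw [ExactPairing.evaluation_coevaluation'']; monoidal

/-- The inverse braiding of `Y` with `X* ⊗ X` supplies one inverse braiding with `X` and cancels one
braiding with `X*`; `braiding_evaluation` converts the other. -/
lemma coendι_braiding_pairingAction {ω : coendObj C ⊗ coendObj C ⟶ 𝟙_ C}
    (hω : ∀ X Y : C, (coendι X ⊗ₘ coendι Y) ≫ ω = hopfPairingComponent X Y) (X Y : C) :
    coendι X ▷ Y ≫ (β_ Y _).inv ≫ pairingAction ω Y = (α_ _ _ _).hom ≫
      (Xᘁ : C) ◁ ((β_ Y X).inv ≫ (β_ X Y).inv) ≫ (α_ _ _ _).inv ≫ ε_ X Xᘁ ▷ Y ≫ (λ_ _).hom := by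
  have n : coendι X ▷ Y ≫ (β_ Y _).inv = (β_ Y _).inv ≫ Y ◁ coendι X :=
    BraidedCategory.braiding_inv_naturality_left _ _
  rw [reassoc_of% n, coendι_pairingAction hω, BraidedCategory.braiding_tensor_right_inv]
  have b := braiding_evaluation X Y
  simp only [comp_whiskerRight, Category.assoc, b]
  simp

lemma coendδ_braiding_pairingAction {ω : coendObj C ⊗ coendObj C ⟶ 𝟙_ C}
    (hω : ∀ X Y : C, (coendι X ⊗ₘ coendι Y) ≫ ω = hopfPairingComponent X Y) (X Y : C) :
    coendδ X ▷ Y ≫ (α_ _ _ _).hom ≫ X ◁ ((β_ Y _).inv ≫ pairingAction ω Y) =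
      (β_ Y X).inv ≫ (β_ X Y).inv := by
  have e := coendι_braiding_pairingAction hω X Y
  calc _ = 𝟙 _ ⊗≫ η_ X Xᘁ ▷ (X ⊗ Y) ⊗≫
        X ◁ (coendι X ▷ Y ≫ (β_ Y _).inv ≫ pairingAction ω Y) := by
        rw [coendδ]
        simp only [tensorLeftHomEquiv, Equiv.coe_fn_mk]
        monoidal
    _ = 𝟙 _ ⊗≫ (η_ X Xᘁ ▷ (X ⊗ Y) ≫ (X ⊗ Xᘁ) ◁ ((β_ Y X).inv ≫ (β_ X Y).inv)) ⊗≫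
        X ◁ ε_ X Xᘁ ▷ Y ⊗≫ 𝟙 _ := by
        rw [e]; monoidal
    _ = 𝟙 _ ⊗≫ ((β_ Y X).inv ≫ (β_ X Y).inv) ⊗≫
        (η_ X Xᘁ ▷ X ⊗≫ X ◁ ε_ X Xᘁ) ▷ Y ⊗≫ 𝟙 _ := by
        rw [← whisker_exchange]; monoidal
    _ = _ := by rw [ExactPairing.evaluation_coevaluation'']; monoidal

variable [RibbonCategory C]

variable (C) in
/-- The automorphism of `L` induced by the inverse twist. -/
noncomputable abbrev coendTwist : coendObj C ⟶ coendObj C :=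
  coendEnd twistInv (fun _ _ f => twistInv_naturality f)

instance : IsIso (coendTwist C) :=
  ⟨coendEnd twistHom (fun _ _ f => (RibbonCategory.twist (C := C)).hom.naturality f),
    coendEnd_comp_eq_id _ _ _ _ twistInv_twist, coendEnd_comp_eq_id _ _ _ _ twist_twistInv⟩

/-- The pairing on `L` obtained from `ω` by inserting inverse twists. -/
noncomputable def twistedPairing (ω : coendObj C ⊗ coendObj C ⟶ 𝟙_ C) :
    coendObj C ⊗ coendObj C ⟶ 𝟙_ C :=
  coendTwist C ▷ _ ≫ _ ◁ coendTwist C ≫ ω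

lemma coendδ_twist (X : C) : coendδ X ≫ X ◁ coendTwist C = twistInv X ≫ coendδ X :=
  coendδ_end _ _ X

lemma pairingAction_twistedPairing (ω : coendObj C ⊗ coendObj C ⟶ 𝟙_ C) (Y : C) :
    pairingAction (twistedPairing ω) Y =
      twistInv Y ▷ _ ≫ Y ◁ coendTwist C ≫ pairingAction ω Y := by
  have h := coendδ_twist Y
  calc _ = (coendδ Y ≫ Y ◁ coendTwist C) ▷ _ ≫ (_ ⊗ _) ◁ coendTwist C ≫ (α_ _ _ _).hom ≫
        Y ◁ ω ≫ (ρ_ _).hom := by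
        rw [pairingAction, twistedPairing]; simp
    _ = _ := by
        rw [h, comp_whiskerRight, Category.assoc, ← whisker_exchange_assoc, pairingAction]

/-- The reason for twisting `ω`: the inserted automorphisms put inverse twists on `X` and `Y`,
completing the inverse double braiding to the inverse twist of `X ⊗ Y`. -/
lemma coendδ_braiding_twistedPairing {ω : coendObj C ⊗ coendObj C ⟶ 𝟙_ C}
    (hω : ∀ X Y : C, (coendι X ⊗ₘ coendι Y) ≫ ω = hopfPairingComponent X Y) (X Y : C) :
    coendδ X ▷ Y ≫ (α_ _ _ _).hom ≫ X ◁ ((β_ Y _).inv ≫ pairingAction (twistedPairing ω) Y) =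
      twistInv (X ⊗ Y) := by
  have n : (β_ Y (coendObj C)).inv ≫ twistInv Y ▷ _ ≫ Y ◁ coendTwist C =
      coendTwist C ▷ Y ≫ _ ◁ twistInv Y ≫ (β_ Y _).inv := by
    rw [BraidedCategory.braiding_inv_naturality_right,
      BraidedCategory.braiding_inv_naturality_left_assoc, whisker_exchange]
  have h := coendδ_twist X
  calc _ = (coendδ X ≫ X ◁ coendTwist C) ▷ Y ≫ (_ ⊗ _) ◁ twistInv Y ≫ (α_ _ _ _).hom ≫
        X ◁ ((β_ Y _).inv ≫ pairingAction ω Y) := by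
        rw [pairingAction_twistedPairing, reassoc_of% n]; monoidal
    _ = twistInv X ▷ Y ≫ X ◁ twistInv Y ≫ coendδ X ▷ Y ≫ (α_ _ _ _).hom ≫
        X ◁ ((β_ Y _).inv ≫ pairingAction ω Y) := by
        rw [h, comp_whiskerRight, Category.assoc, ← whisker_exchange_assoc]
    _ = _ := by rw [coendδ_braiding_pairingAction hω, twistInv_tensor]

/-- The Frobenius form of the central monad, given by the inverse twist. -/
noncomputable def frobeniusForm (N : C) : (centralFunctor C).obj N ⟶ N :=
  -- With the inverse braiding also used in `centralIso`, this family corresponds on `L ⊗ N` to the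
  -- form `L ⟶ 𝟙` given by evaluation after the inverse twist, tensored with `N`.
  centralDesc (fun X => N ◁ twistInv X ≫ (β_ X N).inv) (fun X Y f => by
    rw [← MonoidalCategory.whiskerLeft_comp_assoc, twistInv_naturality]
    simp)

lemma centralδ_frobeniusForm (N X : C) :
    centralδ N X ≫ X ◁ frobeniusForm N = (β_ X N).inv ≫ twistInv X ▷ N := by
  rw [frobeniusForm, centralδ_desc]
  simp

lemma frobeniusForm_naturality {M N : C} (f : M ⟶ N) :
    (centralFunctor C).map f ≫ frobeniusForm N = frobeniusForm M ≫ f := by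
  apply central_hom_ext
  intro X
  rw [MonoidalCategory.whiskerLeft_comp, reassoc_of% centralδ_map, centralδ_frobeniusForm,
    MonoidalCategory.whiskerLeft_comp, reassoc_of% centralδ_frobeniusForm]
  have h : f ▷ X ≫ (β_ X N).inv = (β_ X M).inv ≫ X ◁ f := by simp
  rw [reassoc_of% h, whisker_exchange]

/-- The map `L ⊗ X ⟶ N` obtained from `X ⟶ L ⊗ N` by contraction with a pairing. -/
def contract {L X N : C} (ω : L ⊗ L ⟶ 𝟙_ C) (g : X ⟶ L ⊗ N) : L ⊗ X ⟶ N :=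
  L ◁ g ≫ (α_ _ _ _).inv ≫ ω ▷ N ≫ (λ_ _).hom

/-- Tested on the components at `X` and `Y`, both sides move `N` past `X` and `Y` by inverse
braidings and then apply the inverse twist of `X ⊗ Y`: on the left because the multiplication merges
the indices, on the right by `coendδ_braiding_twistedPairing`. -/
lemma centralMul_frobeniusForm {ω : coendObj C ⊗ coendObj C ⟶ 𝟙_ C}
    (hω : ∀ X Y : C, (coendι X ⊗ₘ coendι Y) ≫ ω = hopfPairingComponent X Y) (N : C) :
    centralMul N ≫ frobeniusForm N =
      (centralIso _).hom ≫ contract (twistedPairing ω) (centralIso N).hom := by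
  apply central_hom_ext
  intro Y
  have hR : centralδ ((centralFunctor C).obj N) Y ≫ Y ◁ ((centralIso _).hom ≫
      contract (twistedPairing ω) (centralIso N).hom) =
      (centralIso N).hom ▷ Y ≫ (α_ _ _ _).hom ≫ _ ◁ (β_ Y N).inv ≫ (α_ _ _ _).inv ≫
        ((β_ Y _).inv ≫ pairingAction (twistedPairing ω) Y) ▷ N := by
    have n : (β_ Y ((centralFunctor C).obj N)).inv ≫ Y ◁ (centralIso N).hom =
      (centralIso N).hom ▷ Y ≫ (β_ Y _).inv :=
      (BraidedCategory.braiding_inv_naturality_left _ _).symm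
    calc _ = (β_ Y _).inv ≫ (coendδ Y ▷ _ ≫ (_ ⊗ _) ◁ (centralIso N).hom) ≫ (α_ _ _ _).hom ≫
          Y ◁ ((α_ _ _ _).inv ≫ twistedPairing ω ▷ N ≫ (λ_ _).hom) := by
          rw [MonoidalCategory.whiskerLeft_comp, reassoc_of% centralδ_iso, contract]
          simp
      _ = (centralIso N).hom ▷ Y ≫ (β_ Y _).inv ≫ coendδ Y ▷ _ ≫ (α_ _ _ _).hom ≫
          Y ◁ ((α_ _ _ _).inv ≫ twistedPairing ω ▷ N ≫ (λ_ _).hom) := by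
          rw [← whisker_exchange, Category.assoc, reassoc_of% n]
      _ = _ := by
          rw [BraidedCategory.braiding_tensor_right_inv, pairingAction]
          monoidal
  rw [hR, MonoidalCategory.whiskerLeft_comp, reassoc_of% centralδ_mul]
  apply central_tensor_hom_ext
  intro X
  have e := centralδ_centralBraid N X Y
  have h := centralδ_frobeniusForm N (X ⊗ Y)
  have hi := centralδ_iso N X
  have k := coendδ_braiding_twistedPairing hω X Y
  calc _ = (α_ _ _ _).hom ≫ (centralδ N (X ⊗ Y) ≫ (X ⊗ Y) ◁ frobeniusForm N) ≫
          (α_ _ _ _).hom := by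
        rw [MonoidalCategory.whiskerLeft_comp, ← Category.assoc (α_ _ _ _).hom, ← Category.assoc,
          e]
        simp
    _ = (β_ X N).inv ▷ Y ≫ (α_ _ _ _).hom ≫ X ◁ (β_ Y N).inv ≫ (α_ _ _ _).inv ≫
          twistInv (X ⊗ Y) ▷ N ≫ (α_ _ _ _).hom := by
        rw [h, BraidedCategory.braiding_tensor_left_inv]; simp
    _ = (β_ X N).inv ▷ Y ≫ (α_ _ _ _).hom ≫ (X ◁ (β_ Y N).inv ≫ coendδ X ▷ _) ≫
          (α_ _ _ _).hom ≫ X ◁ (α_ _ _ _).inv ≫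
          X ◁ ((β_ Y _).inv ≫ pairingAction (twistedPairing ω) Y) ▷ N := by
        rw [← k]; monoidal
    _ = ((β_ X N).inv ≫ coendδ X ▷ N ≫ (α_ _ _ _).hom) ▷ Y ≫ (α_ _ _ _).hom ≫
          X ◁ ((α_ _ _ _).hom ≫ _ ◁ (β_ Y N).inv ≫ (α_ _ _ _).inv ≫
        ((β_ Y _).inv ≫ pairingAction (twistedPairing ω) Y) ▷ N) := by
        rw [whisker_exchange]; monoidal
    _ = _ := by rw [← hi]; simp

end Frobenius

/-! ### The free functor as right adjoint of the forgetful functor -/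

section Ambidextrous

/-- Non-degeneracy makes `L` its own dual with evaluation `ω`, and contraction is then the
transposition of the duality adjunction. -/
lemma contract_bijective {C : Type u} [Category.{v} C] [MonoidalCategory C] {L : C}
    {ω : L ⊗ L ⟶ 𝟙_ C} (h : IsNondegeneratePairing ω) (X N : C) :
    Function.Bijective (contract ω : (X ⟶ L ⊗ N) → (L ⊗ X ⟶ N)) := by
  obtain ⟨p, rfl⟩ := h
  exact (tensorLeftHomEquiv X L L N).symm.bijective

variable {C : Type u} [Category.{v} C] [MonoidalCategory C] [RigidCategory C] [BraidedCategory C]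
  [RibbonCategory C] [HasCoend (innerHom C)]

lemma contract_twistedPairing (ω : coendObj C ⊗ coendObj C ⟶ 𝟙_ C) {X N : C}
    (g : X ⟶ coendObj C ⊗ N) : contract (twistedPairing ω) g =
      coendTwist C ▷ X ≫ contract ω (g ≫ coendTwist C ▷ N) := by
  calc _ = (_ ◁ g ≫ coendTwist C ▷ (coendObj C ⊗ N)) ≫
        _ ◁ coendTwist C ▷ N ≫ (α_ _ _ _).inv ≫ ω ▷ N ≫ (λ_ _).hom := by
        rw [contract, twistedPairing]; monoidal
    _ = _ := by rw [whisker_exchange, contract]; monoidal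

lemma contract_twistedPairing_bijective {ω : coendObj C ⊗ coendObj C ⟶ 𝟙_ C}
    (h : IsNondegeneratePairing ω) (X N : C) :
    Function.Bijective (contract (twistedPairing ω) :
      (X ⟶ coendObj C ⊗ N) → (coendObj C ⊗ X ⟶ N)) := by
  have e : (contract (twistedPairing ω) : (X ⟶ coendObj C ⊗ N) → (coendObj C ⊗ X ⟶ N)) =
      (asIso (coendTwist C ▷ X)).symm.homFromEquiv ∘ contract ω ∘
        (asIso (coendTwist C ▷ N)).homToEquiv := by
    ext g
    simp [contract_twistedPairing]
  rw [e]
  exact (Equiv.bijective _).comp ((contract_bijective h X N).comp (Equiv.bijective _))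

/-- The Frobenius property of `Z`: under `Z ≅ L ⊗ -` the map is contraction with the twisted
pairing. -/
lemma map_comp_mul_frobeniusForm_bijective {ω : coendObj C ⊗ coendObj C ⟶ 𝟙_ C}
    (hω : ∀ X Y : C, (coendι X ⊗ₘ coendι Y) ≫ ω = hopfPairingComponent X Y)
    (h : IsNondegeneratePairing ω) (X N : C) :
    Function.Bijective (fun f : X ⟶ (centralFunctor C).obj N =>
      (centralFunctor C).map f ≫ centralMul N ≫ frobeniusForm N) := by
  have e : (fun f : X ⟶ (centralFunctor C).obj N =>
      (centralFunctor C).map f ≫ centralMul N ≫ frobeniusForm N) =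
      (centralIso X).symm.homFromEquiv ∘ contract (twistedPairing ω) ∘
        (centralIso N).homToEquiv := by
    ext f
    simp only [centralMul_frobeniusForm hω, reassoc_of% centralIso_naturality, contract,
      Function.comp_apply, Iso.homFromEquiv_apply, Iso.homToEquiv_apply, Iso.symm_inv,
      MonoidalCategory.whiskerLeft_comp, Category.assoc]
  rw [e]
  exact (Equiv.bijective _).comp ((contract_twistedPairing_bijective h X N).comp
    (Equiv.bijective _))

/-- Composition with the Frobenius form, from morphisms `X ⟶ F(N)` in the centre to morphisms
`U(X) ⟶ N`. -/
noncomputable def forgetHom (X : Center C) (N : C) (f : X ⟶ (freeCenter C).obj N) : X.1 ⟶ N :=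
  f.f ≫ frobeniusForm N

lemma map_comp_mul_frobeniusForm {X : Center C} {N : C} (f : X ⟶ (freeCenter C).obj N) :
    (centralFunctor C).map f.f ≫ centralMul N ≫ frobeniusForm N =
      centerAction X ≫ forgetHom X N f :=
  (Category.assoc _ _ _).symm.trans
    ((congrArg (· ≫ frobeniusForm N) (map_comp_centerAction f)).trans (Category.assoc _ _ _))

lemma forgetHom_comp_map {X : Center C} {N N' : C} (f : X ⟶ (freeCenter C).obj N) (g : N ⟶ N') :
    forgetHom X N' (f ≫ (freeCenter C).map g) = forgetHom X N f ≫ g :=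
  (Category.assoc _ _ _).trans
    ((congrArg (f.f ≫ ·) (frobeniusForm_naturality g)).trans (Category.assoc _ _ _).symm)

/-- The Frobenius bijection restricts to modules: for a module map `f`, the composite `Z(f) ≫ μ ≫ λ`
is the action followed by `f ≫ λ`, so `f ≫ λ` determines `f`. -/
lemma forgetHom_bijective {ω : coendObj C ⊗ coendObj C ⟶ 𝟙_ C}
    (hω : ∀ X Y : C, (coendι X ⊗ₘ coendι Y) ≫ ω = hopfPairingComponent X Y)
    (h : IsNondegeneratePairing ω) (X : Center C) (N : C) :
    Function.Bijective (forgetHom X N) := by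
  constructor
  · intro f g hfg
    apply Center.ext
    apply (map_comp_mul_frobeniusForm_bijective hω h _ _).1
    exact (map_comp_mul_frobeniusForm f).trans ((congrArg (centerAction X ≫ ·) hfg).trans
      (map_comp_mul_frobeniusForm g).symm)
  · intro g
    obtain ⟨f, hf⟩ := (map_comp_mul_frobeniusForm_bijective hω h _ _).2 (centerAction X ≫ g)
    dsimp only at hf
    -- Injectivity, now for maps `Z(X) ⟶ Z(N)`, reduces this to an equality of maps `Z(Z(X)) ⟶ N`;
    -- by associativity both sides are the multiplication, the action and then `g`.
    have hact : (centralFunctor C).map f ≫ centralMul N = centerAction X ≫ f := by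
      apply (map_comp_mul_frobeniusForm_bijective hω h _ _).1
      dsimp only
      rw [Functor.map_comp, Functor.map_comp, Category.assoc, Category.assoc, hf,
        reassoc_of% centralMul_assoc, reassoc_of% centralMul_naturality, hf,
        reassoc_of% map_centerAction_centerAction]
    refine ⟨centerHomOfAction (Y := (freeCenter C).obj N) f hact, ?_⟩
    change f ≫ frobeniusForm N = g
    -- Inserting the unit exposes `Z(f) ≫ μ ≫ λ`, which is the action followed by `g`; the unit law
    -- of the action leaves `g`.
    have hu : f = centralUnit X.1 ≫ (centralFunctor C).map f ≫ centralMul N := by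
      rw [← reassoc_of% centralUnit_naturality, centralUnit_mul, Category.comp_id]
    rw [hu, Category.assoc, Category.assoc, hf, reassoc_of% centralUnit_centerAction]

/-- If the Hopf pairing is non-degenerate, the free functor is right adjoint to the forgetful
functor of the centre. -/
noncomputable def forgetFreeCenterAdj {ω : coendObj C ⊗ coendObj C ⟶ 𝟙_ C}
    (hω : ∀ X Y : C, (coendι X ⊗ₘ coendι Y) ≫ ω = hopfPairingComponent X Y)
    (h : IsNondegeneratePairing ω) : Center.forget C ⊣ freeCenter C :=
  Adjunction.mkOfHomEquiv
    { homEquiv := fun X N => (Equiv.ofBijective _ (forgetHom_bijective hω h X N)).symm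
      homEquiv_naturality_left_symm := fun {X X' N} f g =>
        Category.assoc f.f g.f (frobeniusForm N)
      homEquiv_naturality_right := fun {X N N'} f g => by
        refine (Equiv.symm_apply_eq _).2 (Eq.trans ?_ (forgetHom_comp_map _ g).symm)
        exact (congrArg (· ≫ g) (Equiv.apply_symm_apply
          (Equiv.ofBijective _ (forgetHom_bijective hω h X N)) f)).symm }

end Ambidextrous

end ModularTensor

theorem mainTheorem4 {k : Type w} [Field k] [IsAlgClosed k] [CharZero k]
    {C : Type u} [Category.{v} C] [Preadditive C] [Linear k C]
    [MonoidalCategory C] [MonoidalPreadditive C] [MonoidalLinear k C]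
    [RigidCategory C] [BraidedCategory C] [ModularTensor.RibbonCategory C]
    (hfin : ModularTensor.IsFiniteLinear k C) (hunit : Simple (𝟙_ C))
    (hmod : ModularTensor.IsModular C) :
    ∃ (_ : ModularTensor.HasCentralCoends C) (F : C ⥤ Center C)
      (adj : F ⊣ Center.forget C),
      F.Additive ∧ F.Linear k ∧
      Nonempty (Center.forget C ⊣ F) ∧
      Nonempty (adj.toMonad ≅ ModularTensor.centralMonad C) := by
  obtain ⟨_, ω, hω, hnd⟩ := hmod
  exact ⟨inferInstance, ModularTensor.freeCenter C, ModularTensor.freeCenterAdj C, inferInstance,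
    inferInstance, ⟨ModularTensor.forgetFreeCenterAdj hω hnd⟩,
    ⟨ModularTensor.freeCenterAdjMonadIso C⟩⟩
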